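/- Let $\Gamma$ be a cancellation monoid (not necessarily commutative), i.e. a monoid in which $\alpha\alpha_1=\alpha\alpha_2$ implies $\alpha_1=\alpha_2$ and $\alpha_1\alpha=\alpha_2\alpha$ implies $\alpha_1=\alpha_2$. Let $R=\bigoplus_{\alpha\in\Gamma}R_\alpha$ be a $\Gamma$-graded associative ring with identity, where the $R_\alpha$ are additive subgroups with $R_\alpha R_\beta\subseteq R_{\alpha\beta}$, and let $N=\bigoplus_{\alpha\in\Gamma}N_\alpha$ be a $\Gamma$-graded left $R$-module, where the $N_\alpha$ are additive subgroups with $R_\alpha N_\beta\subseteq N_{\alpha\beta}$. Graded right $R$-modules $M=\bigoplus_{\alpha\in\Gamma}M_\alpha$ are defined similarly, with $M_\alpha R_\beta\subseteq M_{\alpha\beta}$. For such $M$, the group $M\otimes_R N$ is graded by letting $(M\otimes_R N)_\gamma$ be the subgroup generated by all $m\otimes n$ with $m\in M_\alpha$, $n\in N_\beta$, $\alpha\beta=\gamma$. A homomorphism of graded objects is called homogeneous if it maps the degree $\alpha$ part into the degree $\alpha$ part for every $\alpha\in\Gamma$. The module $N$ is called gr-flat if for every injective homogeneous homomorphism $f:M\to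 M'$ of $\Gamma$-graded right $R$-modules, the map $f\otimes_R 1_N:M\otimes_R N\to M'\otimes_R N$ is homogeneous and injective. A right ideal of $R$ is called homogeneous if it is generated by homogeneous elements, i.e. by elements of $\bigcup_{\alpha\in\Gamma}R_\alpha$. Then $N$ is gr-flat if and only if $\operatorname{Tor}_1^R(R/I,N)=0$ for every homogeneous right ideal $I$ of $R$. -/

import Mathlib

open CategoryTheory MulOpposite
open scoped TensorProduct

/-! Right modules over a (noncommutative) ring `R` are modules over the opposite ring `Rᵐᵒᵖ`;
the right action `m · r` is `op r • m`. A right ideal of `R` is a `Submodule Rᵐᵒᵖ R`. -/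

universe w u v x

noncomputable section

namespace GrTor

section Tensor

variable (R : Type u) [Ring R]
variable (M : Type w) [AddCommGroup M] [Module Rᵐᵒᵖ M]
variable (N : Type v) [AddCommGroup N] [Module R N]

/-- The subgroup of `M ⊗_ℤ N` generated by the elements `(m · r) ⊗ n - m ⊗ (r n)`. -/
def balancedRel : AddSubgroup (M ⊗[ℤ] N) :=
  AddSubgroup.closure
    {z | ∃ (m : M) (r : R) (n : N), z = (op r • m) ⊗ₜ[ℤ] n - m ⊗ₜ[ℤ] (r • n)}

/-- The tensor product `M ⊗_R N` of a right `R`-module `M` and a left `R`-module `N`,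
an abelian group. -/
def Tensor : Type (max w v) := (M ⊗[ℤ] N) ⧸ balancedRel R M N

instance : AddCommGroup (Tensor R M N) :=
  inferInstanceAs (AddCommGroup ((M ⊗[ℤ] N) ⧸ balancedRel R M N))

variable {M N}

/-- The pure tensor `m ⊗ n` in `M ⊗_R N`. -/
def Tensor.tmul (m : M) (n : N) : Tensor R M N :=
  QuotientAddGroup.mk' (balancedRel R M N) (m ⊗ₜ[ℤ] n)

variable {R} {M' : Type w} [AddCommGroup M'] [Module Rᵐᵒᵖ M']

variable (N) in
/-- The homomorphism `f ⊗_R 1_N : M ⊗_R N → M' ⊗_R N`, for `f : M → M'` a homomorphism of right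
`R`-modules. -/
def Tensor.map (f : M →ₗ[Rᵐᵒᵖ] M') : Tensor R M N →+ Tensor R M' N :=
  QuotientAddGroup.map (balancedRel R M N) (balancedRel R M' N)
    (LinearMap.rTensor N f.toAddMonoidHom.toIntLinearMap).toAddMonoidHom <| by
      unfold balancedRel
      rw [AddSubgroup.closure_le]
      rintro _ ⟨m, r, n, rfl⟩
      refine AddSubgroup.subset_closure ⟨f m, r, n, ?_⟩
      simp

theorem Tensor.map_tmul (f : M →ₗ[Rᵐᵒᵖ] M') (m : M) (n : N) :
    Tensor.map N f (Tensor.tmul R m n) = Tensor.tmul R (f m) n := rfl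

theorem Tensor.hom_ext {A : Type*} [AddCommGroup A] {g h : Tensor R M N →+ A}
    (H : ∀ m n, g (Tensor.tmul R m n) = h (Tensor.tmul R m n)) : g = h := by
  refine QuotientAddGroup.addMonoidHom_ext _ ?_
  ext x
  induction x using TensorProduct.induction_on with
  | zero => simp
  | tmul m n => exact H m n
  | add x y hx hy => rw [map_add, map_add, hx, hy]

end Tensor

section Tor

variable (R : Type u) [Ring R] (N : Type v) [AddCommGroup N] [Module R N]

/-- The functor `- ⊗_R N` from right `R`-modules to abelian groups. -/
def tensorFunctor : ModuleCat.{w} Rᵐᵒᵖ ⥤ AddCommGrpCat.{max w v} where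
  obj M := AddCommGrpCat.of (Tensor R M N)
  map f := AddCommGrpCat.ofHom (Tensor.map N f.hom)
  map_id M := by
    ext1
    exact Tensor.hom_ext fun m n => rfl
  map_comp f g := by
    ext1
    exact Tensor.hom_ext fun m n => rfl

instance : (tensorFunctor.{w, u, v} R N).Additive where
  map_add {M M' f g} := by
    ext1
    refine Tensor.hom_ext fun m n => ?_
    change QuotientAddGroup.mk' (balancedRel R M' N) ((f.hom m + g.hom m) ⊗ₜ[ℤ] n) =
      QuotientAddGroup.mk' (balancedRel R M' N) (f.hom m ⊗ₜ[ℤ] n) +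
        QuotientAddGroup.mk' (balancedRel R M' N) (g.hom m ⊗ₜ[ℤ] n)
    rw [TensorProduct.add_tmul, map_add]

/-- `Tor_i^R(M, N)` for a right `R`-module `M` and a left `R`-module `N`: the `i`-th left derived
functor of `- ⊗_R N`, evaluated at `M`. -/
def Tor (i : ℕ) (M : Type (max u w)) [AddCommGroup M] [Module Rᵐᵒᵖ M] :
    AddCommGrpCat.{max u v w} :=
  ((tensorFunctor.{max u w, u, v} R N).leftDerived i).obj (ModuleCat.of Rᵐᵒᵖ M)

end Tor

section Graded

variable {Γ : Type x} [DecidableEq Γ] [AddCancelMonoid Γ]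
variable {R : Type u} [Ring R] (𝒜 : Γ → AddSubgroup R)

/-- `ℳ` is a grading of the right `R`-module `M`, where `R` is graded by `𝒜`:
`M = ⨁ ℳ α` and `ℳ α · 𝒜 β ⊆ ℳ (α + β)`. (The monoid `Γ` is written additively,
but it need not be commutative.) -/
structure IsRightGrading {M : Type w} [AddCommGroup M] [Module Rᵐᵒᵖ M]
    (ℳ : Γ → AddSubgroup M) : Prop where
  isInternal : DirectSum.IsInternal ℳ
  smul_mem : ∀ ⦃α β : Γ⦄ ⦃m : M⦄ ⦃r : R⦄, m ∈ ℳ α → r ∈ 𝒜 β → op r • m ∈ ℳ (α + β)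

/-- A homogeneous right ideal: a right ideal generated by homogeneous elements. -/
def IsHomogeneousRightIdeal (I : Submodule Rᵐᵒᵖ R) : Prop :=
  ∃ S : Set R, (∀ a ∈ S, SetLike.IsHomogeneousElem 𝒜 a) ∧ I = Submodule.span Rᵐᵒᵖ S

variable (R) in
/-- The degree `γ` part of `M ⊗_R N`: the subgroup generated by the `m ⊗ n` with `m`, `n`
homogeneous and `deg m + deg n = γ`. -/
def tensorGrading {M : Type w} [AddCommGroup M] [Module Rᵐᵒᵖ M] (ℳ : Γ → AddSubgroup M)
    {N : Type v} [AddCommGroup N] [Module R N] (𝒩 : Γ → AddSubgroup N) (γ : Γ) :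
    AddSubgroup (Tensor R M N) :=
  AddSubgroup.closure
    {z | ∃ (α β : Γ) (m : M) (n : N), m ∈ ℳ α ∧ n ∈ 𝒩 β ∧ α + β = γ ∧ z = Tensor.tmul R m n}

/-- The graded left `R`-module `N` (with grading `𝒩`) is gr-flat: for every homogeneous (that is,
degree preserving) monomorphism `f : M → M'` of graded right `R`-modules,
`f ⊗_R 1_N : M ⊗_R N → M' ⊗_R N` is a homogeneous monomorphism. The universe of the test modules
`M`, `M'` is the first universe parameter `w`. -/
def IsGrFlat {N : Type v} [AddCommGroup N] [Module R N] (𝒩 : Γ → AddSubgroup N) : Prop :=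
  ∀ (M M' : Type w) [AddCommGroup M] [Module Rᵐᵒᵖ M] [AddCommGroup M'] [Module Rᵐᵒᵖ M']
    (ℳ : Γ → AddSubgroup M) (ℳ' : Γ → AddSubgroup M') (f : M →ₗ[Rᵐᵒᵖ] M'),
    IsRightGrading 𝒜 ℳ → IsRightGrading 𝒜 ℳ' →
    (∀ α, ∀ m ∈ ℳ α, f m ∈ ℳ' α) → Function.Injective f →
      (∀ γ, ∀ z ∈ tensorGrading R ℳ 𝒩 γ, Tensor.map N f z ∈ tensorGrading R ℳ' 𝒩 γ) ∧
        Function.Injective (Tensor.map N f)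

end Graded

end GrTor

end

/-! Let `D = Hom_ℤ(N, ℚ/ℤ)`, a right `R`-module. Since `Hom_ℤ(M ⊗_R N, ℚ/ℤ) ≅ Hom_R(M, D)` and `ℚ/ℤ`
is an injective cogenerator, `f ⊗ 1_N` is injective exactly when every map `M → D` extends along
`f`. So gr-flatness is an extension property of `D`, and a graded Baer criterion
(`exists_extension_of_isHomogeneousSubmodule`) reduces it to the inclusions `I ⊆ R` of homogeneous
right ideals. No grading on `D` is needed: only the domains of the partial maps have to be
homogeneous. On the other side, `isZero_tor_one_iff` identifies the vanishing of `Tor_1(R/I, N)`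
with injectivity of `I ⊗ N → R ⊗ N`, by right exactness and a Schanuel-type comparison of projective
presentations. -/

noncomputable section

namespace GrTor

/-! ### The character module of `N`. -/

section Dual

variable {R : Type u} [Ring R] {N : Type v} [AddCommGroup N] [Module R N]

variable (N) in
/-- The character group of a left `R`-module `N`, regarded as a right `R`-module. -/
def RightDual : Type v := N →+ AddCircle (1 : ℚ)

instance : AddCommGroup (RightDual N) := inferInstanceAs (AddCommGroup (N →+ AddCircle (1 : ℚ)))

instance : FunLike (RightDual N) N (AddCircle (1 : ℚ)) :=
  inferInstanceAs (FunLike (N →+ AddCircle (1 : ℚ)) N (AddCircle (1 : ℚ)))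

instance : AddMonoidHomClass (RightDual N) N (AddCircle (1 : ℚ)) :=
  inferInstanceAs (AddMonoidHomClass (N →+ AddCircle (1 : ℚ)) N (AddCircle (1 : ℚ)))

theorem RightDual.ext {φ ψ : RightDual N} (h : ∀ n, φ n = ψ n) : φ = ψ := DFunLike.ext _ _ h

@[simp] theorem RightDual.add_apply (φ ψ : RightDual N) (n : N) : (φ + ψ) n = φ n + ψ n := rfl

@[simp] theorem RightDual.zero_apply (n : N) : (0 : RightDual N) n = 0 := rfl

instance : SMul Rᵐᵒᵖ (RightDual N) where
  smul r φ := (AddMonoidHom.comp (φ : N →+ AddCircle (1 : ℚ))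
    (DistribSMul.toAddMonoidHom N r.unop) :)

@[simp] theorem RightDual.smul_apply (r : Rᵐᵒᵖ) (φ : RightDual N) (n : N) :
    (r • φ) n = φ (r.unop • n) := rfl

instance : Module Rᵐᵒᵖ (RightDual N) where
  one_smul φ := RightDual.ext fun n => by simp
  mul_smul r s φ := RightDual.ext fun n => by simp [mul_smul]
  smul_zero r := RightDual.ext fun n => by simp
  smul_add r φ ψ := RightDual.ext fun n => by simp
  add_smul r s φ := RightDual.ext fun n => by simp [add_smul]
  zero_smul φ := RightDual.ext fun n => by simp

end Dual

/-! ### Tensor-hom adjunction into `ℚ/ℤ` and right exactness. -/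

section Adjunction

variable {R : Type u} [Ring R]
variable {M : Type w} [AddCommGroup M] [Module Rᵐᵒᵖ M]
variable {N : Type v} [AddCommGroup N] [Module R N]

theorem Tensor.add_tmul (m m' : M) (n : N) :
    Tensor.tmul R (m + m') n = Tensor.tmul R m n + Tensor.tmul R m' n := by
  simp only [Tensor.tmul, TensorProduct.add_tmul, map_add]
  rfl

theorem Tensor.tmul_add (m : M) (n n' : N) :
    Tensor.tmul R m (n + n') = Tensor.tmul R m n + Tensor.tmul R m n' := by
  simp only [Tensor.tmul, TensorProduct.tmul_add, map_add]
  rfl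

theorem Tensor.smul_tmul (m : M) (r : R) (n : N) :
    Tensor.tmul R (op r • m) n = Tensor.tmul R m (r • n) := by
  refine (QuotientAddGroup.eq_iff_sub_mem).2 ?_
  exact AddSubgroup.subset_closure ⟨m, r, n, rfl⟩

/-- The character of `M ⊗_R N` attached to an `R`-linear map from `M` to the dual of `N`. -/
def Tensor.liftDual (φ : M →ₗ[Rᵐᵒᵖ] RightDual N) : Tensor R M N →+ AddCircle (1 : ℚ) :=
  QuotientAddGroup.lift (balancedRel R M N)
    (TensorProduct.liftAddHom
      (AddMonoidHom.mk' (fun m => (φ m : N →+ AddCircle (1 : ℚ)))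
        fun m m' => by rw [map_add]; rfl)
      fun z m n => by
        have h : φ (z • m) = z • φ m := map_zsmul φ z m
        have h' : φ m (z • n) = z • φ m n := map_zsmul (φ m) z n
        change φ (z • m) n = φ m (z • n)
        rw [h, h']
        rfl) <| by
    unfold balancedRel
    rw [AddSubgroup.closure_le]
    rintro _ ⟨m, r, n, rfl⟩
    change _ = _
    rw [map_sub, sub_eq_zero]
    change φ (op r • m) n = φ m (r • n)
    rw [φ.map_smul]
    rfl

/-- The `R`-linear map from `M` to the dual of `N` attached to a character of `M ⊗_R N`. -/
def Tensor.curryDual (c : Tensor R M N →+ AddCircle (1 : ℚ)) : M →ₗ[Rᵐᵒᵖ] RightDual N where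
  toFun m := (AddMonoidHom.mk' (fun n => c (Tensor.tmul R m n)) fun n n' => by
    rw [Tensor.tmul_add, map_add] : N →+ AddCircle (1 : ℚ))
  map_add' m m' := RightDual.ext fun n => by
    change c (Tensor.tmul R (m + m') n) = c (Tensor.tmul R m n) + c (Tensor.tmul R m' n)
    rw [Tensor.add_tmul, map_add]
  map_smul' r m := RightDual.ext fun n => by
    change c (Tensor.tmul R (op r.unop • m) n) = c (Tensor.tmul R m (r.unop • n))
    rw [Tensor.smul_tmul]

variable {M' : Type w} [AddCommGroup M'] [Module Rᵐᵒᵖ M']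

/-- Injectivity of `ℚ/ℤ` extends the character of `M ⊗ N` attached to `φ` to `M' ⊗ N`; currying
gives `ψ`. -/
theorem exists_extension_of_injective_map {f : M →ₗ[Rᵐᵒᵖ] M'}
    (hf : Function.Injective (Tensor.map N f)) (φ : M →ₗ[Rᵐᵒᵖ] RightDual N) :
    ∃ ψ : M' →ₗ[Rᵐᵒᵖ] RightDual N, ψ ∘ₗ f = φ := by
  obtain ⟨c, hc⟩ := CharacterModule.dual_surjective_of_injective
    (Tensor.map N f).toIntLinearMap hf (Tensor.liftDual φ)
  refine ⟨Tensor.curryDual c, LinearMap.ext fun m => RightDual.ext fun n => ?_⟩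
  exact DFunLike.congr_fun hc (Tensor.tmul R m n)

/-- Every character of `M ⊗ N` factors through `f ⊗ 1`, hence kills its kernel, and characters
separate points. -/
theorem injective_map_of_exists_extension {f : M →ₗ[Rᵐᵒᵖ] M'}
    (H : ∀ φ : M →ₗ[Rᵐᵒᵖ] RightDual N, ∃ ψ : M' →ₗ[Rᵐᵒᵖ] RightDual N, ψ ∘ₗ f = φ) :
    Function.Injective (Tensor.map N f) := by
  rw [injective_iff_map_eq_zero]
  intro z hz
  refine CharacterModule.eq_zero_of_character_apply fun c => ?_
  obtain ⟨ψ, hψ⟩ := H (Tensor.curryDual c)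
  have h : (c : Tensor R M N →+ AddCircle (1 : ℚ)) = (Tensor.liftDual ψ).comp (Tensor.map N f) :=
    Tensor.hom_ext fun m n => (DFunLike.congr_fun (LinearMap.congr_fun hψ m) n).symm
  exact (DFunLike.congr_fun h z).trans ((congrArg (Tensor.liftDual ψ) hz).trans (map_zero _))

theorem Tensor.map_id_apply (z : Tensor R M N) : Tensor.map N (LinearMap.id : M →ₗ[Rᵐᵒᵖ] M) z = z :=
  DFunLike.congr_fun (Tensor.hom_ext (g := Tensor.map N LinearMap.id) (h := AddMonoidHom.id _)
    fun _ _ => rfl) z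

variable {M'' : Type w} [AddCommGroup M''] [Module Rᵐᵒᵖ M'']

theorem Tensor.map_comp_apply (g : M' →ₗ[Rᵐᵒᵖ] M'') (f : M →ₗ[Rᵐᵒᵖ] M') (z : Tensor R M N) :
    Tensor.map N (g ∘ₗ f) z = Tensor.map N g (Tensor.map N f z) :=
  DFunLike.congr_fun (Tensor.hom_ext (g := Tensor.map N (g ∘ₗ f))
    (h := (Tensor.map N g).comp (Tensor.map N f)) fun _ _ => rfl) z

theorem Tensor.map_add_apply (f g : M →ₗ[Rᵐᵒᵖ] M') (z : Tensor R M N) :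
    Tensor.map N (f + g) z = Tensor.map N f z + Tensor.map N g z :=
  DFunLike.congr_fun (Tensor.hom_ext (g := Tensor.map N (f + g))
    (h := Tensor.map N f + Tensor.map N g) fun m n => Tensor.add_tmul (f m) (g m) n) z

theorem Tensor.map_surjective {f : M →ₗ[Rᵐᵒᵖ] M'} (hf : Function.Surjective f) :
    Function.Surjective (Tensor.map N f) := by
  intro z
  obtain ⟨z, rfl⟩ := QuotientAddGroup.mk_surjective z
  induction z using TensorProduct.induction_on with
  | zero => exact ⟨0, map_zero _⟩
  | tmul m n =>
    obtain ⟨m, rfl⟩ := hf m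
    exact ⟨Tensor.tmul R m n, rfl⟩
  | add x y hx hy =>
    obtain ⟨a, ha⟩ := hx
    obtain ⟨b, hb⟩ := hy
    exact ⟨a + b, by rw [map_add, ha, hb]; rfl⟩

/-- A character vanishing on the image of `f ⊗ 1` curries to a map killing `ker g`; it descends to
`M''`, so the character factors through `g ⊗ 1`. -/
theorem Tensor.map_exact {f : M →ₗ[Rᵐᵒᵖ] M'} {g : M' →ₗ[Rᵐᵒᵖ] M''} (hfg : Function.Exact f g)
    (hg : Function.Surjective g) : Function.Exact (Tensor.map N f) (Tensor.map N g) := by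
  intro z
  constructor
  · intro hz
    rw [← AddMonoidHom.coe_range, SetLike.mem_coe, ← QuotientAddGroup.eq_zero_iff]
    refine CharacterModule.eq_zero_of_character_apply fun c => ?_
    let c' : Tensor R M' N →+ AddCircle (1 : ℚ) :=
      AddMonoidHom.comp (c : _ →+ AddCircle (1 : ℚ))
        (QuotientAddGroup.mk' (Tensor.map N f).range)
    have hc' : ∀ y, c' (Tensor.map N f y) = 0 := fun y => by
      have : QuotientAddGroup.mk' (Tensor.map N f).range (Tensor.map N f y) = 0 :=
        (QuotientAddGroup.eq_zero_iff _).2 ⟨y, rfl⟩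
      change c _ = 0
      rw [this, map_zero]
    have hker : LinearMap.ker g ≤ LinearMap.ker (Tensor.curryDual c') := by
      intro m hm
      obtain ⟨m, rfl⟩ := (hfg m).1 hm
      exact RightDual.ext fun n => hc' (Tensor.tmul R m n)
    let ψ : M'' →ₗ[Rᵐᵒᵖ] RightDual N :=
      (LinearMap.ker g).liftQ (Tensor.curryDual c') hker ∘ₗ
        (g.quotKerEquivOfSurjective hg).symm.toLinearMap
    have hψ : ∀ m, ψ (g m) = Tensor.curryDual c' m := fun m => by
      have : (g.quotKerEquivOfSurjective hg).symm (g m) = (LinearMap.ker g).mkQ m := by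
        rw [LinearEquiv.symm_apply_eq]; rfl
      simp [ψ, this]
    have h : c' = (Tensor.liftDual ψ).comp (Tensor.map N g) :=
      Tensor.hom_ext fun m n => (DFunLike.congr_fun (hψ m) n).symm
    change c' z = 0
    rw [h, AddMonoidHom.comp_apply, hz, map_zero]
  · rintro ⟨y, rfl⟩
    rw [← Tensor.map_comp_apply, hfg.linearMap_comp_eq_zero]
    exact DFunLike.congr_fun (Tensor.hom_ext (g := Tensor.map N (0 : M →ₗ[Rᵐᵒᵖ] M'')) (h := 0)
      fun m n => by
        rw [Tensor.map_tmul, LinearMap.zero_apply, Tensor.tmul, TensorProduct.zero_tmul, map_zero]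
        rfl) y

end Adjunction

/-! ### Independence of the projective presentation. -/

section Schanuel

variable {R : Type u} [Ring R] {N : Type v} [AddCommGroup N] [Module R N]
variable {P Q A : Type w} [AddCommGroup P] [AddCommGroup Q] [AddCommGroup A]
  [Module Rᵐᵒᵖ P] [Module Rᵐᵒᵖ Q] [Module Rᵐᵒᵖ A]

/-- For projective presentations `p : P → A` and `q : Q → A`, injectivity of
`ker p ⊗ N → P ⊗ N` implies injectivity of `ker q ⊗ N → Q ⊗ N`. -/
theorem injective_map_ker_subtype_of_projective [Module.Projective Rᵐᵒᵖ P]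
    [Module.Projective Rᵐᵒᵖ Q] {p : P →ₗ[Rᵐᵒᵖ] A} {q : Q →ₗ[Rᵐᵒᵖ] A}
    (hp : Function.Surjective p) (hq : Function.Surjective q)
    (H : Function.Injective (Tensor.map N (LinearMap.ker p).subtype)) :
    Function.Injective (Tensor.map N (LinearMap.ker q).subtype) := by
  obtain ⟨a, ha⟩ := Module.projective_lifting_property p q hp
  obtain ⟨b, hb⟩ := Module.projective_lifting_property q p hq
  have ha' : ∀ y, p (a y) = q y := LinearMap.congr_fun ha
  have hb' : ∀ y, q (b y) = p y := LinearMap.congr_fun hb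
  let a₀ : LinearMap.ker q →ₗ[Rᵐᵒᵖ] LinearMap.ker p :=
    a.restrict fun y hy => by rw [LinearMap.mem_ker] at *; rw [ha', hy]
  let b₀ : LinearMap.ker p →ₗ[Rᵐᵒᵖ] LinearMap.ker q :=
    b.restrict fun y hy => by rw [LinearMap.mem_ker] at *; rw [hb', hy]
  let s : Q →ₗ[Rᵐᵒᵖ] LinearMap.ker q :=
    (LinearMap.id - b ∘ₗ a).codRestrict (LinearMap.ker q) fun y => by
      rw [LinearMap.mem_ker]; simp [ha', hb']
  -- The identity of `ker q` is a map through `ker p` plus a map through `Q`; both summands will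
  -- kill `z`.
  have hs : (LinearMap.id : LinearMap.ker q →ₗ[Rᵐᵒᵖ] LinearMap.ker q) =
      b₀ ∘ₗ a₀ + s ∘ₗ (LinearMap.ker q).subtype := by
    ext y
    simp [a₀, b₀, s]
  rw [injective_iff_map_eq_zero]
  intro z hz
  have hz' : Tensor.map N a₀ z = 0 := by
    apply H
    rw [map_zero, ← Tensor.map_comp_apply]
    change Tensor.map N (a ∘ₗ (LinearMap.ker q).subtype) z = 0
    rw [Tensor.map_comp_apply, hz, map_zero]
  rw [← Tensor.map_id_apply z, hs, Tensor.map_add_apply, Tensor.map_comp_apply,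
    Tensor.map_comp_apply, hz, hz', map_zero, map_zero, add_zero]

end Schanuel

/-! ### `Tor_1(R/I, N)` as the obstruction to injectivity. -/

section TorOne

variable {R : Type u} [Ring R] {N : Type v} [AddCommGroup N] [Module R N]

/-- `e ⊗ 1` factors as `P₁ ⊗ N ↠ ker p ⊗ N → P₀ ⊗ N`, and right exactness makes the kernel of the
first factor the image of `d ⊗ 1`. -/
theorem exact_map_iff_injective_map_ker_subtype {P₂ P₁ P₀ A : Type w} [AddCommGroup P₂]
    [AddCommGroup P₁] [AddCommGroup P₀] [AddCommGroup A] [Module Rᵐᵒᵖ P₂] [Module Rᵐᵒᵖ P₁]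
    [Module Rᵐᵒᵖ P₀] [Module Rᵐᵒᵖ A] {d : P₂ →ₗ[Rᵐᵒᵖ] P₁} {e : P₁ →ₗ[Rᵐᵒᵖ] P₀}
    {p : P₀ →ₗ[Rᵐᵒᵖ] A} (hde : Function.Exact d e) (hep : Function.Exact e p) :
    Function.Exact (Tensor.map N d) (Tensor.map N e) ↔
      Function.Injective (Tensor.map N (LinearMap.ker p).subtype) := by
  let e' : P₁ →ₗ[Rᵐᵒᵖ] LinearMap.ker p :=
    e.codRestrict (LinearMap.ker p) fun y => (hep (e y)).2 ⟨y, rfl⟩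
  have he' : Function.Surjective e' := by
    rintro ⟨y, hy⟩
    obtain ⟨z, rfl⟩ := (hep y).1 hy
    exact ⟨z, rfl⟩
  have hde' : Function.Exact d e' := fun y => by
    rw [← hde y, ← Subtype.coe_inj]
    rfl
  have hT := Tensor.map_exact (N := N) hde' he'
  have hfac (z : Tensor R P₁ N) :
      Tensor.map N e z = Tensor.map N (LinearMap.ker p).subtype (Tensor.map N e' z) := by
    rw [← Tensor.map_comp_apply]
    rfl
  constructor
  · intro h
    rw [injective_iff_map_eq_zero]
    intro z hz
    obtain ⟨z, rfl⟩ := Tensor.map_surjective he' z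
    rw [← hfac] at hz
    exact (hT z).2 ((h z).1 hz)
  · intro h z
    rw [hfac, map_eq_zero_iff _ h]
    exact hT z

instance : Module.Projective Rᵐᵒᵖ R :=
  let e : Rᵐᵒᵖ ≃ₗ[Rᵐᵒᵖ] R :=
    { opAddEquiv.symm with map_smul' := fun _ _ => rfl }
  Module.Projective.of_equiv e

theorem isZero_tor_one_iff (I : Submodule Rᵐᵒᵖ R) :
    Limits.IsZero (Tor.{u, u, v} R N 1 (R ⧸ I)) ↔
      Function.Injective (Tensor.map N I.subtype) := by
  let P := projectiveResolution (ModuleCat.of.{u} Rᵐᵒᵖ (R ⧸ I))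
  let F := tensorFunctor.{u, u, v} R N
  let d : P.complex.X 2 →ₗ[Rᵐᵒᵖ] P.complex.X 1 := (P.complex.d 2 1).hom
  let e : P.complex.X 1 →ₗ[Rᵐᵒᵖ] P.complex.X 0 := (P.complex.d 1 0).hom
  let p : P.complex.X 0 →ₗ[Rᵐᵒᵖ] R ⧸ I := (P.π.f 0).hom
  have hp : Function.Surjective p := (ModuleCat.epi_iff_surjective (P.π.f 0)).1 inferInstance
  have hde : Function.Exact d e :=
    (ShortComplex.ShortExact.moduleCat_exact_iff_function_exact _).1 (P.exact_succ 0)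
  have hep : Function.Exact e p :=
    (ShortComplex.ShortExact.moduleCat_exact_iff_function_exact _).1 P.exact₀
  have : Module.Projective Rᵐᵒᵖ (P.complex.X 0) :=
    (IsProjective.iff_projective (P.complex.X 0)).2 (P.projective 0)
  have key : Limits.IsZero (Tor.{u, u, v} R N 1 (R ⧸ I)) ↔
      Function.Exact (Tensor.map N d) (Tensor.map N e) := by
    refine (P.isoLeftDerivedObj F 1).isZero_iff.trans ?_
    refine (HomologicalComplex.exactAt_iff_isZero_homology _ _).symm.trans ?_
    refine (HomologicalComplex.exactAt_iff' _ 2 1 0 (by simp) (by simp)).trans ?_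
    exact ShortComplex.ab_exact_iff_function_exact _
  rw [key, exact_map_iff_injective_map_ker_subtype hde hep]
  have hq : Function.Surjective I.mkQ := I.mkQ_surjective
  -- Trade the chosen resolution for the presentation `R → R/I`, whose kernel is `I`.
  have : Function.Injective (Tensor.map N (LinearMap.ker p).subtype) ↔
      Function.Injective (Tensor.map N (LinearMap.ker I.mkQ).subtype) :=
    ⟨injective_map_ker_subtype_of_projective hp hq,
      injective_map_ker_subtype_of_projective hq hp⟩
  rw [this, I.ker_mkQ]

end TorOne

open DirectSum

/-! ### Homogeneous submodules and induced gradings. -/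

section Homogeneous

variable {Γ : Type x} [DecidableEq Γ]

/-- A submodule containing the homogeneous components of all its elements. -/
def IsHomogeneousSubmodule {S : Type u} [Semiring S] {M : Type w} [AddCommGroup M] [Module S M]
    (ℳ : Γ → AddSubgroup M) [Decomposition ℳ] (P : Submodule S M) : Prop :=
  ∀ y ∈ P, ∀ γ, (decompose ℳ y γ : M) ∈ P

section

variable {S : Type u} [Semiring S] {M : Type w} [AddCommGroup M] [Module S M]
  {ℳ : Γ → AddSubgroup M} [Decomposition ℳ]

theorem IsHomogeneousSubmodule.sup {P Q : Submodule S M} (hP : IsHomogeneousSubmodule ℳ P)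
    (hQ : IsHomogeneousSubmodule ℳ Q) : IsHomogeneousSubmodule ℳ (P ⊔ Q) := by
  intro y hy γ
  obtain ⟨p, hp, q, hq, rfl⟩ := Submodule.mem_sup.1 hy
  rw [decompose_add, DirectSum.add_apply, AddSubgroup.coe_add]
  exact Submodule.add_mem_sup (hP p hp γ) (hQ q hq γ)

theorem mem_of_forall_decompose_mem {P : Submodule S M} {y : M}
    (h : ∀ γ, (decompose ℳ y γ : M) ∈ P) : y ∈ P := by
  classical
  rw [← sum_support_decompose ℳ y]
  exact sum_mem fun γ _ => h γ

theorem map_decompose {M' : Type v} [AddCommGroup M'] {ℳ' : Γ → AddSubgroup M'}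
    [Decomposition ℳ'] (f : M →+ M') (hf : ∀ α, ∀ m ∈ ℳ α, f m ∈ ℳ' α) (m : M) (γ : Γ) :
    f (decompose ℳ m γ) = decompose ℳ' (f m) γ := by
  induction m using Decomposition.inductionOn ℳ with
  | zero => simp
  | @homogeneous i m =>
    by_cases h : i = γ
    · subst h
      rw [decompose_of_mem_same _ m.2, decompose_of_mem_same _ (hf _ _ m.2)]
    · rw [decompose_of_mem_ne _ m.2 h, decompose_of_mem_ne _ (hf _ _ m.2) h, map_zero]
  | add a b ha hb => simp [ha, hb]

theorem isInternal_comap {L : Type v} [AddCommGroup L] (f : L →+ M) (hf : Function.Injective f)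
    (h : ∀ y γ, (decompose ℳ (f y) γ : M) ∈ f.range) :
    IsInternal fun α => (ℳ α).comap f := by
  classical
  let g (α : Γ) : (ℳ α).comap f →+ ℳ α :=
    (f.comp ((ℳ α).comap f).subtype).codRestrict (ℳ α) fun y => y.2
  have hg (z : ⨁ α, (ℳ α).comap f) :
      f (DirectSum.coeAddMonoidHom (fun α => (ℳ α).comap f) z) =
        DirectSum.coeAddMonoidHom ℳ (DirectSum.map g z) := by
    induction z using DirectSum.induction_on with
    | zero => simp
    | of i y =>
      simp only [DirectSum.coeAddMonoidHom_of, DirectSum.map_of]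
      rfl
    | add a b ha hb => simp [ha, hb]
  constructor
  · intro z z' hz
    have := congrArg f hz
    rw [hg, hg] at this
    have hz' := (Decomposition.isInternal ℳ).injective this
    refine (DirectSum.map_injective g).2 (fun α a b hab => ?_) hz'
    exact Subtype.ext (hf (congrArg Subtype.val hab))
  · intro y
    choose c hc using h y
    refine ⟨∑ γ ∈ (decompose ℳ (f y)).support,
      DirectSum.of (fun α => (ℳ α).comap f) γ ⟨c γ, ?_⟩, hf ?_⟩
    · rw [AddSubgroup.mem_comap, hc]
      exact SetLike.coe_mem _
    · conv_rhs => rw [← sum_support_decompose ℳ (f y)]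
      simp [hc]

end

variable [AddCancelMonoid Γ] {R : Type u} [Ring R] {𝒜 : Γ → AddSubgroup R}
variable {M : Type w} [AddCommGroup M] [Module Rᵐᵒᵖ M] {ℳ : Γ → AddSubgroup M} [Decomposition ℳ]

theorem IsRightGrading.comap (hℳ : IsRightGrading 𝒜 ℳ) {L : Type v} [AddCommGroup L]
    [Module Rᵐᵒᵖ L] (f : L →ₗ[Rᵐᵒᵖ] M) (hf : Function.Injective f)
    (h : IsHomogeneousSubmodule ℳ (LinearMap.range f)) :
    IsRightGrading 𝒜 fun α => (ℳ α).comap f.toAddMonoidHom where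
  isInternal := isInternal_comap f.toAddMonoidHom hf fun y γ => h (f y) ⟨y, rfl⟩ γ
  smul_mem α β m r hm hr := by
    change f (op r • m) ∈ ℳ (α + β)
    rw [map_smul]
    exact hℳ.smul_mem hm hr

variable [Decomposition 𝒜]

theorem decompose_op_smul_of_mem (hℳ : IsRightGrading 𝒜 ℳ) {α : Γ} {m : M} (hm : m ∈ ℳ α) (r : R)
    (β : Γ) : (decompose ℳ (op r • m) (α + β) : M) = op (decompose 𝒜 r β : R) • m := by
  induction r using Decomposition.inductionOn 𝒜 with
  | zero => simp
  | @homogeneous i r =>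
    have hmem := hℳ.smul_mem hm r.2
    by_cases h : i = β
    · subst h
      rw [decompose_of_mem_same _ r.2, decompose_of_mem_same _ hmem]
    -- Left cancellation in `Γ`: `i ≠ β` gives `α + i ≠ α + β`.
    · rw [decompose_of_mem_ne _ r.2 h, decompose_of_mem_ne _ hmem (by simpa using h)]
      simp
  | add a b ha hb => simp [add_smul, ha, hb]

theorem decompose_op_smul_mem (hℳ : IsRightGrading 𝒜 ℳ) {P : Submodule Rᵐᵒᵖ M} {α : Γ} {m : M}
    (hm : m ∈ ℳ α) (hP : m ∈ P) (r : R) (γ : Γ) : (decompose ℳ (op r • m) γ : M) ∈ P := by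
  induction r using Decomposition.inductionOn 𝒜 with
  | zero => simp
  | @homogeneous i r =>
    have hmem := hℳ.smul_mem hm r.2
    by_cases h : α + i = γ
    · subst h
      rw [decompose_of_mem_same _ hmem]
      exact P.smul_mem _ hP
    · rw [decompose_of_mem_ne _ hmem h]
      exact P.zero_mem
  | add a b ha hb =>
    rw [MulOpposite.op_add, add_smul, decompose_add, DirectSum.add_apply, AddSubgroup.coe_add]
    exact P.add_mem ha hb

theorem isHomogeneousSubmodule_span (hℳ : IsRightGrading 𝒜 ℳ) {T : Set M}
    (hT : ∀ m ∈ T, SetLike.IsHomogeneousElem ℳ m) :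
    IsHomogeneousSubmodule ℳ (Submodule.span Rᵐᵒᵖ T) := by
  intro y hy γ
  induction hy using Submodule.closure_induction with
  | zero => simp
  | add a b _ _ ha hb =>
    rw [decompose_add, DirectSum.add_apply, AddSubgroup.coe_add]
    exact Submodule.add_mem _ ha hb
  | smul_mem r m hm =>
    obtain ⟨α, hα⟩ := hT m hm
    exact decompose_op_smul_mem hℳ hα (Submodule.subset_span hm) r.unop γ

variable (𝒜) in
theorem isRightGrading_self [SetLike.GradedMul 𝒜] : IsRightGrading 𝒜 𝒜 where
  isInternal := Decomposition.isInternal 𝒜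
  smul_mem _ _ _ _ hm hr := SetLike.GradedMul.mul_mem hm hr

theorem isHomogeneousRightIdeal_iff [SetLike.GradedMul 𝒜] {I : Submodule Rᵐᵒᵖ R} :
    IsHomogeneousRightIdeal 𝒜 I ↔ IsHomogeneousSubmodule 𝒜 I := by
  constructor
  · rintro ⟨T, hT, rfl⟩
    exact isHomogeneousSubmodule_span (isRightGrading_self 𝒜) hT
  · intro hI
    refine ⟨{a | a ∈ I ∧ SetLike.IsHomogeneousElem 𝒜 a}, fun a ha => ha.2, le_antisymm ?_ ?_⟩
    · intro y hy
      exact mem_of_forall_decompose_mem (ℳ := 𝒜) fun γ =>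
        Submodule.subset_span ⟨hI y hy γ, γ, SetLike.coe_mem _⟩
    · exact Submodule.span_le.2 fun a ha => ha.1

/-- The linear map `r ↦ m · r`. -/
def rightOrbitMap (m : M) : R →ₗ[Rᵐᵒᵖ] M where
  toFun r := op r • m
  map_add' r s := by rw [MulOpposite.op_add, add_smul]
  map_smul' s r := mul_smul s (op r) m

@[simp] theorem rightOrbitMap_apply (m : M) (r : R) : rightOrbitMap m r = op r • m := rfl

/-- The degree `α + γ` component of `m · r` is `m · r_γ`, so it lies in `P` whenever `m · r` does.
-/
theorem IsHomogeneousSubmodule.comap_rightOrbitMap (hℳ : IsRightGrading 𝒜 ℳ)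
    {P : Submodule Rᵐᵒᵖ M} (hP : IsHomogeneousSubmodule ℳ P) {α : Γ} {m : M} (hm : m ∈ ℳ α) :
    IsHomogeneousSubmodule 𝒜 (P.comap (rightOrbitMap m)) := by
  intro r hr γ
  rw [Submodule.mem_comap, rightOrbitMap_apply, ← decompose_op_smul_of_mem hℳ hm]
  exact hP _ hr _

end Homogeneous

/-! ### The graded Baer criterion. -/

section Baer

variable {Γ : Type x} [DecidableEq Γ] [AddCancelMonoid Γ]
  {R : Type u} [Ring R] {𝒜 : Γ → AddSubgroup R} [Decomposition 𝒜]
  {M : Type w} [AddCommGroup M] [Module Rᵐᵒᵖ M] {ℳ : Γ → AddSubgroup M} [Decomposition ℳ]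
  {D : Type v} [AddCommGroup D] [Module Rᵐᵒᵖ D]

/-- The extension step in the graded Baer criterion. -/
theorem exists_extension_of_homogeneous_mem
    (hℳ : IsRightGrading 𝒜 ℳ)
    (H : ∀ I : Submodule Rᵐᵒᵖ R, IsHomogeneousSubmodule 𝒜 I → ∀ φ : I →ₗ[Rᵐᵒᵖ] D,
      ∃ ψ : R →ₗ[Rᵐᵒᵖ] D, ψ ∘ₗ I.subtype = φ)
    (g : M →ₗ.[Rᵐᵒᵖ] D) (hg : IsHomogeneousSubmodule ℳ g.domain) {α : Γ} {m : M} (hm : m ∈ ℳ α) :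
    ∃ g' : M →ₗ.[Rᵐᵒᵖ] D, g ≤ g' ∧ IsHomogeneousSubmodule ℳ g'.domain ∧ m ∈ g'.domain := by
  -- Extend `r ↦ g (m · r)` from the ideal of those `r` with `m · r` in the domain to all of `R`;
  -- then `h 1` is a consistent value at `m`.
  obtain ⟨h, hh⟩ := H (g.domain.comap (rightOrbitMap m)) (hg.comap_rightOrbitMap hℳ hm)
    (g.toFun ∘ₗ (rightOrbitMap m).restrict fun _ hr => hr)
  have hh' (r : R) (hr : op r • m ∈ g.domain) : op r • h 1 = g ⟨op r • m, hr⟩ := by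
    rw [← map_smul, op_smul_eq_mul, one_mul]
    exact LinearMap.congr_fun hh ⟨r, hr⟩
  let g₁ : M →ₗ.[Rᵐᵒᵖ] D := LinearPMap.mkSpanSingleton' m (h 1) fun c hc => by
    have hc' : op c.unop • m = 0 := hc
    have := hh' c.unop (hc' ▸ g.domain.zero_mem)
    refine this.trans ?_
    simp only [hc']
    exact g.map_zero
  have hagree (y : g.domain) (z : g₁.domain) (hyz : (y : M) = z) : g y = g₁ z := by
    obtain ⟨y, hy⟩ := y
    obtain ⟨z, hz⟩ := z
    obtain rfl : y = z := hyz
    obtain ⟨c, rfl⟩ := Submodule.mem_span_singleton.1 hz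
    exact (hh' c.unop hy).symm.trans (LinearPMap.mkSpanSingleton'_apply m (h 1) _ c hz).symm
  refine ⟨g.sup g₁ hagree, g.left_le_sup g₁ hagree, ?_, ?_⟩
  · exact hg.sup (isHomogeneousSubmodule_span hℳ fun y hy => ⟨α, by
      rwa [Set.mem_singleton_iff.1 hy]⟩)
  · exact Submodule.mem_sup_right (Submodule.mem_span_singleton_self m)

/-- A graded Baer criterion: if maps to `D` extend along the inclusions of homogeneous right ideals
in `R`, then they extend along inclusions of homogeneous submodules. -/
theorem exists_extension_of_isHomogeneousSubmodule
    (hℳ : IsRightGrading 𝒜 ℳ)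
    (H : ∀ I : Submodule Rᵐᵒᵖ R, IsHomogeneousSubmodule 𝒜 I → ∀ φ : I →ₗ[Rᵐᵒᵖ] D,
      ∃ ψ : R →ₗ[Rᵐᵒᵖ] D, ψ ∘ₗ I.subtype = φ)
    {P : Submodule Rᵐᵒᵖ M} (hP : IsHomogeneousSubmodule ℳ P) (φ : P →ₗ[Rᵐᵒᵖ] D) :
    ∃ ψ : M →ₗ[Rᵐᵒᵖ] D, ψ ∘ₗ P.subtype = φ := by
  obtain ⟨g, hle, hmax⟩ := zorn_le_nonempty₀
    {g : M →ₗ.[Rᵐᵒᵖ] D | IsHomogeneousSubmodule ℳ g.domain}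
    (fun c hcs hc y hy => by
      refine ⟨LinearPMap.sSup c hc.directedOn, fun z hz γ => ?_,
        fun z hz => LinearPMap.le_sSup _ hz⟩
      obtain ⟨g, hg, hz⟩ := (LinearPMap.mem_domain_sSup_iff ⟨y, hy⟩ hc.directedOn).1 hz
      exact (LinearPMap.mem_domain_sSup_iff ⟨y, hy⟩ hc.directedOn).2 ⟨g, hg, hcs hg z hz γ⟩)
    ⟨P, φ⟩ hP
  -- A maximal domain absorbs every homogeneous element, hence all components of `y`.
  have htop (y : M) : y ∈ g.domain := by
    refine mem_of_forall_decompose_mem (ℳ := ℳ) fun γ => ?_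
    obtain ⟨g', hgg', hg', hy⟩ := exists_extension_of_homogeneous_mem hℳ H g hmax.prop
      (SetLike.coe_mem (decompose ℳ y γ))
    exact (hmax.le_of_ge hg' hgg').1 hy
  refine ⟨g.toFun ∘ₗ LinearMap.id.codRestrict g.domain htop, LinearMap.ext fun y => ?_⟩
  exact (hle.2 (x := y) (y := ⟨y, htop y⟩) rfl).symm

end Baer

/-! ### Gr-flatness tested on homogeneous right ideals. -/

section Flat

variable {Γ : Type x} [AddCancelMonoid Γ] {R : Type u} [Ring R] {𝒜 : Γ → AddSubgroup R}
  {N : Type v} [AddCommGroup N] [Module R N] {𝒩 : Γ → AddSubgroup N}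

theorem map_mem_tensorGrading {M M' : Type w} [AddCommGroup M] [Module Rᵐᵒᵖ M] [AddCommGroup M']
    [Module Rᵐᵒᵖ M'] {ℳ : Γ → AddSubgroup M} {ℳ' : Γ → AddSubgroup M'} {f : M →ₗ[Rᵐᵒᵖ] M'}
    (hf : ∀ α, ∀ m ∈ ℳ α, f m ∈ ℳ' α) {γ : Γ} {z : Tensor R M N}
    (hz : z ∈ tensorGrading R ℳ 𝒩 γ) : Tensor.map N f z ∈ tensorGrading R ℳ' 𝒩 γ := by
  suffices tensorGrading R ℳ 𝒩 γ ≤ (tensorGrading R ℳ' 𝒩 γ).comap (Tensor.map N f) from this hz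
  refine (AddSubgroup.closure_le _).2 ?_
  rintro _ ⟨α, β, m, n, hm, hn, hαβ, rfl⟩
  exact AddSubgroup.subset_closure ⟨α, β, f m, n, hf α m hm, hn, hαβ, rfl⟩

variable [DecidableEq Γ] [Decomposition 𝒜]

theorem isGrFlat_of_injective_map_subtype
    (H : ∀ I : Submodule Rᵐᵒᵖ R, IsHomogeneousSubmodule 𝒜 I →
      Function.Injective (Tensor.map N I.subtype)) :
    IsGrFlat.{w, u, v, x} 𝒜 𝒩 := by
  intro M M' _ _ _ _ ℳ ℳ' f hℳ hℳ' hf hinj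
  refine ⟨fun γ z hz => map_mem_tensorGrading hf hz, injective_map_of_exists_extension fun φ => ?_⟩
  let _ := hℳ.isInternal.chooseDecomposition
  let _ := hℳ'.isInternal.chooseDecomposition
  have hrange : IsHomogeneousSubmodule ℳ' (LinearMap.range f) := by
    rintro _ ⟨m, rfl⟩ γ
    exact ⟨decompose ℳ m γ, map_decompose f.toAddMonoidHom hf m γ⟩
  obtain ⟨ψ, hψ⟩ := exists_extension_of_isHomogeneousSubmodule hℳ'
    (fun I hI => exists_extension_of_injective_map (H I hI)) hrange
    (φ ∘ₗ (LinearEquiv.ofInjective f hinj).symm.toLinearMap)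
  refine ⟨ψ, LinearMap.ext fun m => ?_⟩
  refine (LinearMap.congr_fun hψ (LinearEquiv.ofInjective f hinj m)).trans ?_
  simp

theorem IsGrFlat.injective_map_subtype [SetLike.GradedMul 𝒜]
    (h : IsGrFlat.{max u w, u, v, x} 𝒜 𝒩)
    {I : Submodule Rᵐᵒᵖ R} (hI : IsHomogeneousSubmodule 𝒜 I) :
    Function.Injective (Tensor.map N I.subtype) := by
  let eI : ULift.{w} I ≃ₗ[Rᵐᵒᵖ] I := ULift.moduleEquiv
  let eR : ULift.{w} R ≃ₗ[Rᵐᵒᵖ] R := ULift.moduleEquiv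
  let jI : ULift.{w} I →ₗ[Rᵐᵒᵖ] R := I.subtype ∘ₗ eI.toLinearMap
  let f : ULift.{w} I →ₗ[Rᵐᵒᵖ] ULift.{w} R := eR.symm.toLinearMap ∘ₗ jI
  have hjI : Function.Injective jI := I.injective_subtype.comp eI.injective
  have hrI : LinearMap.range jI = I := by simp [jI, LinearMap.range_comp]
  have hR := isRightGrading_self 𝒜
  have key := (h (ULift.{w} I) (ULift.{w} R) _ _ f (hR.comap jI hjI (hrI.symm ▸ hI))
    (hR.comap eR.toLinearMap eR.injective fun y _ γ => by simp)
    (fun α m hm => hm) (eR.symm.injective.comp hjI)).2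
  -- The test modules live in a larger universe than `I` and `R`; the extension property, unlike
  -- `Tensor.map`, passes directly across the `ULift` equivalences.
  refine injective_map_of_exists_extension fun φ => ?_
  obtain ⟨ψ, hψ⟩ := exists_extension_of_injective_map key (φ ∘ₗ eI.toLinearMap)
  refine ⟨ψ ∘ₗ eR.symm.toLinearMap, LinearMap.ext fun y => ?_⟩
  exact LinearMap.congr_fun hψ (eI.symm y)

end Flat

end GrTor

end

theorem lemma2p7 {Γ : Type x} [DecidableEq Γ] [AddCancelMonoid Γ]
    {R : Type u} [Ring R] (𝒜 : Γ → AddSubgroup R)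
    [DirectSum.Decomposition 𝒜] [SetLike.GradedMul 𝒜]
    {N : Type v} [AddCommGroup N] [Module R N] (𝒩 : Γ → AddSubgroup N)
    [DirectSum.Decomposition 𝒩] [SetLike.GradedSMul 𝒜 𝒩] :
    GrTor.IsGrFlat.{max u w, u, v, x} 𝒜 𝒩 ↔
      ∀ I : Submodule Rᵐᵒᵖ R, GrTor.IsHomogeneousRightIdeal 𝒜 I →
        Limits.IsZero (GrTor.Tor.{u, u, v} R N 1 (R ⧸ I)) := by
  refine ⟨fun h I hI => ?_, fun h => ?_⟩
  · rw [GrTor.isZero_tor_one_iff]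
    exact h.injective_map_subtype (GrTor.isHomogeneousRightIdeal_iff.1 hI)
  · refine GrTor.isGrFlat_of_injective_map_subtype fun I hI => ?_
    rw [← GrTor.isZero_tor_one_iff]
    exact h I (GrTor.isHomogeneousRightIdeal_iff.2 hI)
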